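/- Let $\lambda_1,P_1,T_I,T_E>0$, $\alpha>2$ and $\varepsilon\ge 0$. Let $\Phi_1=\{(x,t_x)\}$ be a homogeneous Poisson point process on $\mathbb{R}^2\times\mathbb{R}$ (space and time) with intensity $\lambda_1$ times Lebesgue measure, whose points carry i.i.d. marks $h_x\sim\mathrm{Exp}(1)$ that are independent of $\Phi_1$. A transmitter $(x,t_x)$ is active at time $t$ if $t_x\le t\le t_x+T_I$; write $\phi(t,t_x)=\mathbf{1}(t_x\le t\le t_x+T_I)$ and $r_x=\|x\|$. Let $$E_H=\int_0^{T_E}y(t)\,dt,\qquad y(t)=P_1\sum_{(x,t_x)\in\Phi_1}\phi(t,t_x)\,h_x\,(1+r_x^{\alpha})^{-1},$$ be the total energy harvested during $[0,T_E]$ at the origin. Let $\psi(t)$ be the length of time within $[0,T_E]$ during which a transmitter starting at time $t$ is active, i.e. $\psi(t)=\int_0^{T_E}\phi(\tau,t)\,d\tau$; explicitly, $\psi(t)=T_I+t$ for $-T_I<t\le\min(0,T_E-T_I)$, $\psi(t)=\min(T_I,T_E)$ for $\min(0,T_E-T_I)<t\le\max(0,T_E-T_I)$, $\psi(t)=T_E-t$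 for $\max(0,T_E-T_I)<t<T_E$, and $\psi(t)=0$ otherwise. For real $z$ put $$\mathcal{F}(z)=\exp\left(2\pi\lambda_1\int_{-T_I}^{T_E}\int_0^\infty\frac{\imath zP_1\psi(t)\,u}{1+u^\alpha-\imath zP_1\psi(t)}\,du\,dt\right).$$ Then the integral defining $\mathcal{F}(z)$ converges absolutely for every real $z$, the function $z\mapsto \Im[e^{-\imath z\varepsilon}\mathcal{F}(z)]/z$ is integrable on $(0,\infty)$, and the energy-coverage probability is $$\mathbb{P}(E_H>\varepsilon)=\frac12+\frac1\pi\int_0^\infty\frac{\Im\left[e^{-\imath z\varepsilon}\mathcal{F}(z)\right]}{z}\,dz.$$ -/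

import Mathlib

open MeasureTheory ProbabilityTheory Set
open scoped ENNReal NNReal

noncomputable section

namespace WirelessHarvest

/-- The plane `ℝ²` with its Euclidean norm. -/
abbrev Plane : Type := EuclideanSpace ℝ (Fin 2)

/-- The number (possibly infinite) of the random points `X 0 ω, X 1 ω, …` that lie in `A`. -/
def pointCount {E Ω : Type*} (X : ℕ → Ω → E) (A : Set E) (ω : Ω) : ℕ∞ :=
  Set.encard {n : ℕ | X n ω ∈ A}

/-- The random points `X 0, X 1, …` form a Poisson point process on `E` with intensity measure
`Λ`: the number of points in a measurable set of finite intensity is Poisson distributed with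
parameter the intensity of that set, and the numbers of points in finitely many pairwise disjoint
measurable sets are independent.  (When `Λ` is infinite, such a process has infinitely many points
almost surely, so that enumerating them by `ℕ` is no restriction.) -/
structure IsPoissonPointProcess {E Ω : Type*} [MeasurableSpace E] [MeasurableSpace Ω]
    (X : ℕ → Ω → E) (Λ : Measure E) (P : Measure Ω) : Prop where
  measurable_point : ∀ n, Measurable (X n)
  count_hasLaw : ∀ A : Set E, MeasurableSet A → Λ A ≠ ∞ →
    HasLaw (pointCount X A)
      ((poissonMeasure (Λ A).toNNReal).map (fun k : ℕ => (k : ℕ∞))) P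
  count_indep : ∀ (m : ℕ) (A : Fin m → Set E), (∀ i, MeasurableSet (A i)) →
    Pairwise (fun i j => Disjoint (A i) (A j)) →
    iIndepFun (fun i => pointCount X (A i)) P

/-- The random points `X` carry independent `Exp(1)` marks `h`: the marks are independent and
identically distributed, and independent of the points. -/
structure HasIndepExpMarks {E Ω : Type*} [MeasurableSpace E] [MeasurableSpace Ω]
    (X : ℕ → Ω → E) (h : ℕ → Ω → ℝ) (P : Measure Ω) : Prop where
  measurable_mark : ∀ n, Measurable (h n)
  mark_hasLaw : ∀ n, HasLaw (h n) (expMeasure 1) P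
  mark_indep : iIndepFun h P
  mark_indep_point : IndepFun (fun ω n => h n ω) (fun ω n => X n ω) P

/-- `φ(t, s) = 1(s ≤ t ≤ s + T_I)`: a transmitter that starts at time `s` is active at time `t`. -/
def active (TI t s : ℝ) : ℝ :=
  (Set.Icc s (s + TI)).indicator (fun _ => (1 : ℝ)) t

/-- The power available for harvesting at the origin at time `t`,
`y(t) = P₁ ∑ φ(t, t_x) h_x (1 + r_x ^ α)⁻¹`, summed over the points `(x, t_x)` of the
process, as an element of `[0, ∞]`. -/
def incidentPower {Ω : Type*} (P₁ α TI : ℝ) (X : ℕ → Ω → Plane × ℝ) (h : ℕ → Ω → ℝ)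
    (ω : Ω) (t : ℝ) : ℝ≥0∞ :=
  ENNReal.ofReal P₁ *
    ∑' n, ENNReal.ofReal (active TI t (X n ω).2 * h n ω * (1 + ‖(X n ω).1‖ ^ α)⁻¹)

/-- The total harvested energy `E_H = ∫₀^{T_E} y(t) dt`, as an element of `[0, ∞]`. -/
def harvestedEnergy {Ω : Type*} (P₁ α TI TE : ℝ) (X : ℕ → Ω → Plane × ℝ) (h : ℕ → Ω → ℝ)
    (ω : Ω) : ℝ≥0∞ :=
  ∫⁻ t in Set.Icc 0 TE, incidentPower P₁ α TI X h ω t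

/-- The time `ψ(t)` for which a transmitter that starts at time `t` is active within `[0, T_E]`:
it rises with slope `1` from `t = -T_I`, stays at `min(T_I, T_E)`, and falls with slope `-1` to
`0` at `t = T_E`. -/
def overlap (TI TE t : ℝ) : ℝ :=
  if t ≤ -TI then 0
  else if t ≤ min 0 (TE - TI) then TI + t
  else if t ≤ max 0 (TE - TI) then min TI TE
  else if t < TE then TE - t
  else 0

/-- `ψ(t) = ∫₀^{T_E} φ(τ, t) dτ`. -/
theorem overlap_eq_integral {TI TE : ℝ} (hTI : 0 < TI) (hTE : 0 < TE) (t : ℝ) :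
    overlap TI TE t = ∫ τ in (0 : ℝ)..TE, active TI τ t := by
  have h1 : (∫ τ in (0 : ℝ)..TE, active TI τ t)
      = (volume (Set.Icc t (t + TI) ∩ Set.Ioc 0 TE)).toReal := by
    rw [intervalIntegral.integral_of_le hTE.le]
    unfold active
    rw [integral_indicator measurableSet_Icc]
    simp [Measure.real]
  have h2 : volume (Set.Icc t (t + TI) ∩ Set.Ioc 0 TE)
      = volume (Set.Icc t (t + TI) ∩ Set.Icc 0 TE) :=
    measure_congr (Filter.EventuallyEq.rfl.inter Ioc_ae_eq_Icc)
  rw [h1, h2, Set.Icc_inter_Icc, Real.volume_Icc, ENNReal.toReal_ofReal']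
  simp only [overlap, max_def, min_def]
  grind

/-- The integrand `ı z P₁ ψ(t) u / (1 + u ^ α - ı z P₁ ψ(t))`. -/
def charIntegrand (P₁ α TI TE z t u : ℝ) : ℂ :=
  (Complex.I * z * P₁ * (overlap TI TE t : ℝ) * u) /
    (1 + ((u ^ α : ℝ) : ℂ) - Complex.I * z * P₁ * (overlap TI TE t : ℝ))

/-- `F(z) = exp (2πλ₁ ∫_{-T_I}^{T_E} ∫₀^∞ ı z P₁ ψ(t) u / (1 + u ^ α - ı z P₁ ψ(t)) du dt)`. -/
def energyCharFun (l₁ P₁ α TI TE z : ℝ) : ℂ :=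
  Complex.exp (2 * Real.pi * l₁ *
    ∫ t in (-TI)..TE, ∫ u in Set.Ioi (0 : ℝ), charIntegrand P₁ α TI TE z t u)

end WirelessHarvest

end

namespace WirelessHarvest

open Filter Topology

/-! By Tonelli the harvested energy is the shot noise `∑ h n * f (X n)` with response `f (x, t) = P₁
ψ(t) / (1 + ‖x‖ ^ α)` (`harvestedEnergy_eq_shotNoise`). Since `α > 2` and `ψ` is bounded with
bounded support, `f` is integrable, so by Campbell's formula the energy has a finite mean.

Averaging over the exponential marks replaces each factor `exp (i z h f)` by `1 / (1 - i z f)`.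
Writing this as `exp (-g)` with `g = log (1 - i z f)`, which has nonnegative real part, the complex
Laplace functional `integral_exp_neg_tsum` yields `exp (∫ (1 / (1 - i z f) - 1) dΛ)`
(`integral_exp_shotNoise`). Polar coordinates turn this into `F(z)` (`energyCharFun_eq`).

The tail formula is Gil-Pelaez inversion (`measureReal_Ioi_eq_gilPelaez`), proved by inserting a
damping factor `exp (-δ z)`, applying Fubini, and letting `δ → 0`: the damped sine integral is an
arctangent, which tends to a multiple of the sign. The first moment controls the integrand near `z =
0`. For large `z`, `|F(z)| = exp (-l₁ ∫ (z f)² / (1 + (z f)²))`, and `z f ≥ 1` on a set of volume of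
order `z ^ (2 / α)`, so `F` decays like a stretched exponential (`norm_energyCharFun_le`).
Integrability of `F` also excludes atoms. -/

/-! ### Damped sine and cosine integrals -/

theorem integrableOn_exp_neg_mul {δ : ℝ} (hδ : 0 < δ) :
    IntegrableOn (fun z : ℝ => Real.exp (-δ * z)) (Ioi 0) :=
  exp_neg_integrableOn_Ioi 0 hδ

theorem integral_exp_neg_mul_cos {δ : ℝ} (hδ : 0 < δ) (x : ℝ) :
    ∫ z in Ioi (0 : ℝ), Real.exp (-δ * z) * Real.cos (z * x) = δ / (δ ^ 2 + x ^ 2) := by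
  have hre : ((-δ + x * Complex.I : ℂ)).re < 0 := by simpa using hδ
  have key := integral_exp_mul_complex_Ioi hre 0
  have hint := integrableOn_exp_mul_complex_Ioi hre 0
  have h2 := integral_re hint
  rw [key] at h2
  have h3 : ∀ z : ℝ, RCLike.re (Complex.exp ((-δ + x * Complex.I : ℂ) * z))
      = Real.exp (-δ * z) * Real.cos (z * x) := by
    intro z
    simp [Complex.exp_re, mul_comm]
  simp only [h3] at h2
  rw [h2]
  simp [Complex.div_re, Complex.normSq_apply]
  ring

/-- Differentiating in `x` under the integral cancels the `1 / z` and leaves the damped cosine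
integral, which is the derivative of the arctangent; both sides vanish at `x = 0`. -/
theorem integral_exp_neg_mul_sin_div {δ : ℝ} (hδ : 0 < δ) (x : ℝ) :
    ∫ z in Ioi (0 : ℝ), Real.exp (-δ * z) * (Real.sin (z * x) / z) = Real.arctan (x / δ) := by
  have hder : ∀ y : ℝ, HasDerivAt
      (fun x => ∫ z in Ioi (0 : ℝ), Real.exp (-δ * z) * (Real.sin (z * x) / z))
      (δ / (δ ^ 2 + y ^ 2)) y := by
    intro y
    rw [← integral_exp_neg_mul_cos hδ y]
    refine (hasDerivAt_integral_of_dominated_loc_of_deriv_le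
      (F' := fun x z => Real.exp (-δ * z) * Real.cos (z * x))
      (bound := fun z => Real.exp (-δ * z)) (s := univ) univ_mem ?_ ?_ ?_ ?_ ?_ ?_).2
    · exact Eventually.of_forall fun x => (by fun_prop : Measurable _).aestronglyMeasurable
    · refine ((integrableOn_exp_neg_mul hδ).mul_const |y|).mono'
        (by fun_prop : Measurable _).aestronglyMeasurable ?_
      refine (ae_restrict_mem measurableSet_Ioi).mono fun z (hz : 0 < z) => ?_
      rw [norm_mul, Real.norm_eq_abs, Real.abs_exp, Real.norm_eq_abs, abs_div, abs_of_pos hz]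
      gcongr
      rw [div_le_iff₀ hz]
      refine Real.abs_sin_le_abs.trans ?_
      rw [abs_mul, abs_of_pos hz, mul_comm]
    · exact (by fun_prop : Measurable _).aestronglyMeasurable
    · refine Eventually.of_forall fun z x _ => ?_
      rw [norm_mul, Real.norm_eq_abs, Real.abs_exp, Real.norm_eq_abs]
      exact mul_le_of_le_one_right (Real.exp_pos _).le (Real.abs_cos_le_one _)
    · exact integrableOn_exp_neg_mul hδ
    · refine (ae_restrict_mem measurableSet_Ioi).mono fun z (hz : 0 < z) x _ => ?_
      have h1 := ((((hasDerivAt_id x).const_mul z).sin).div_const z).const_mul (Real.exp (-δ * z))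
      refine h1.congr_deriv ?_
      simp only [id, mul_one]
      field_simp
  have hder2 : ∀ y : ℝ, HasDerivAt (fun x => Real.arctan (x / δ)) (δ / (δ ^ 2 + y ^ 2)) y := by
    intro y
    refine (((hasDerivAt_id y).div_const δ).arctan).congr_deriv ?_
    simp only [id]
    field_simp
  have hd := fun y => (hder y).sub (hder2 y)
  have hc := is_const_of_deriv_eq_zero (fun y => (hd y).differentiableAt)
    (fun y => by rw [(hd y).deriv, sub_self]) x 0
  simpa [sub_eq_zero] using hc

/-! ### Gil-Pelaez inversion -/

section GilPelaez

theorem exp_mul_charFun {μ : Measure ℝ} (ε z : ℝ) :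
    Complex.exp (-Complex.I * z * ε) * charFun μ z
      = ∫ x, Complex.exp ((z * (x - ε) : ℝ) * Complex.I) ∂μ := by
  rw [charFun_apply_real, ← integral_const_mul]
  congr with x
  rw [← Complex.exp_add]
  congr 1
  push_cast
  ring

theorem norm_exp_mul_charFun {μ : Measure ℝ} (ε z : ℝ) :
    ‖Complex.exp (-Complex.I * z * ε) * charFun μ z‖ = ‖charFun μ z‖ := by
  rw [norm_mul, Complex.norm_exp]
  simp

variable {μ : Measure ℝ} [IsProbabilityMeasure μ]

theorem integrable_exp_ofReal_mul_I (ε z : ℝ) :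
    Integrable (fun x : ℝ => Complex.exp ((z * (x - ε) : ℝ) * Complex.I)) μ := by
  refine Integrable.of_bound (C := 1) (by fun_prop : Measurable _).aestronglyMeasurable ?_
  exact Eventually.of_forall fun x => (Complex.norm_exp_ofReal_mul_I _).le

theorem im_exp_mul_charFun (ε z : ℝ) :
    (Complex.exp (-Complex.I * z * ε) * charFun μ z).im = ∫ x, Real.sin (z * (x - ε)) ∂μ := by
  rw [exp_mul_charFun]
  refine (integral_im (integrable_exp_ofReal_mul_I ε z)).symm.trans ?_
  congr with x
  exact Complex.exp_ofReal_mul_I_im _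

theorem re_exp_mul_charFun (ε z : ℝ) :
    (Complex.exp (-Complex.I * z * ε) * charFun μ z).re = ∫ x, Real.cos (z * (x - ε)) ∂μ := by
  rw [exp_mul_charFun]
  refine (integral_re (integrable_exp_ofReal_mul_I ε z)).symm.trans ?_
  congr with x
  exact Complex.exp_ofReal_mul_I_re _

/-- On `(0, 1]` the bound `|sin (z (x - ε))| ≤ z |x - ε|` and the first moment absorb the `1 / z`;
beyond `1` the quotient is at most `‖charFun μ z‖`. -/
theorem integrableOn_im_exp_mul_charFun_div (hm : Integrable (fun x : ℝ => x) μ)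
    (hF : IntegrableOn (charFun μ) (Ioi 0)) (ε : ℝ) :
    IntegrableOn (fun z : ℝ => (Complex.exp (-Complex.I * z * ε) * charFun μ z).im / z)
      (Ioi 0) := by
  have hmeas : Measurable
      (fun z : ℝ => (Complex.exp (-Complex.I * z * ε) * charFun μ z).im / z) := by
    have := measurable_charFun (μ := μ)
    fun_prop
  have hm' : Integrable (fun x : ℝ => x - ε) μ := hm.sub (integrable_const ε)
  rw [← Ioc_union_Ioi_eq_Ioi zero_le_one]
  refine IntegrableOn.union ?_ ?_
  · refine Measure.integrableOn_of_bounded (M := ∫ x, |x - ε| ∂μ) (by simp)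
      hmeas.aestronglyMeasurable ?_
    refine (ae_restrict_mem measurableSet_Ioc).mono fun z hz => ?_
    rw [norm_div, Real.norm_eq_abs, Real.norm_eq_abs, abs_of_pos hz.1, div_le_iff₀ hz.1,
      im_exp_mul_charFun, ← integral_mul_const]
    refine (abs_integral_le_integral_abs).trans ?_
    refine integral_mono_of_nonneg (Eventually.of_forall fun _ => abs_nonneg _)
      (hm'.abs.mul_const z) (Eventually.of_forall fun x => ?_)
    refine Real.abs_sin_le_abs.trans ?_
    rw [abs_mul, abs_of_pos hz.1, mul_comm]
  · refine (hF.mono_set (Ioi_subset_Ioi zero_le_one)).norm.mono' hmeas.aestronglyMeasurable ?_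
    refine (ae_restrict_mem measurableSet_Ioi).mono fun z (hz : 1 < z) => ?_
    rw [norm_div, Real.norm_eq_abs, Real.norm_eq_abs, abs_of_pos (zero_lt_one.trans hz)]
    refine (div_le_self (abs_nonneg _) hz.le).trans ?_
    exact (Complex.abs_im_le_norm _).trans (norm_exp_mul_charFun ε z).le

/-- The damping is what makes Fubini legitimate: the double integrand is dominated by `exp (-δ z) |x
- ε|`. -/
theorem integral_exp_neg_mul_im_charFun {δ : ℝ} (hδ : 0 < δ)
    (hm : Integrable (fun x : ℝ => x) μ) (ε : ℝ) :
    ∫ z in Ioi (0 : ℝ), Real.exp (-δ * z) *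
      ((Complex.exp (-Complex.I * z * ε) * charFun μ z).im / z)
      = ∫ x, Real.arctan ((x - ε) / δ) ∂μ := by
  have hm' : Integrable (fun x : ℝ => x - ε) μ := hm.sub (integrable_const ε)
  simp_rw [← integral_exp_neg_mul_sin_div hδ, im_exp_mul_charFun]
  rw [← integral_integral_swap]
  · simp_rw [integral_const_mul, integral_div]
  · refine (Integrable.mul_prod (integrableOn_exp_neg_mul hδ) hm'.norm).mono'
      (by fun_prop : Measurable _).aestronglyMeasurable ?_
    have : ∀ᵐ p ∂((volume.restrict (Ioi (0 : ℝ))).prod μ), 0 < p.1 :=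
      Measure.quasiMeasurePreserving_fst.ae (ae_restrict_mem measurableSet_Ioi)
    refine this.mono fun p hp => ?_
    simp only [Function.uncurry]
    rw [norm_mul, Real.norm_eq_abs, Real.abs_exp, norm_div, Real.norm_of_nonneg hp.le]
    gcongr
    rw [div_le_iff₀ hp]
    refine Real.abs_sin_le_abs.trans ?_
    rw [abs_mul, abs_of_pos hp, mul_comm, Real.norm_eq_abs]

theorem integral_exp_neg_mul_re_charFun {δ : ℝ} (hδ : 0 < δ) (ε : ℝ) :
    ∫ z in Ioi (0 : ℝ), Real.exp (-δ * z) *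
      (Complex.exp (-Complex.I * z * ε) * charFun μ z).re
      = ∫ x, δ / (δ ^ 2 + (x - ε) ^ 2) ∂μ := by
  simp_rw [← integral_exp_neg_mul_cos hδ, re_exp_mul_charFun]
  rw [← integral_integral_swap]
  · simp_rw [integral_const_mul]
  · refine (Integrable.mul_prod (integrableOn_exp_neg_mul hδ)
      (integrable_const (1 : ℝ) (μ := μ))).mono'
      (by fun_prop : Measurable _).aestronglyMeasurable ?_
    refine Eventually.of_forall fun p => ?_
    simp only [Function.uncurry]
    rw [norm_mul, Real.norm_eq_abs, Real.abs_exp, Real.norm_eq_abs]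
    gcongr
    exact Real.abs_cos_le_one _

/-- The Poisson kernel `δ / (δ² + (x - ε)²)` equals `1 / δ` at `ε`, while its `μ`-integral is a
damped cosine transform bounded by `∫ ‖charFun μ‖` uniformly in `δ`. Hence an atom at `ε` has mass
`O(δ)`. -/
theorem measure_singleton_eq_zero_of_integrable_charFun
    (hF : IntegrableOn (charFun μ) (Ioi 0)) (ε : ℝ) : μ.real {ε} = 0 := by
  have hle : ∀ δ : ℝ, 0 < δ → μ.real {ε} ≤ δ * ∫ z in Ioi (0 : ℝ), ‖charFun μ z‖ := by
    intro δ hδ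
    have hb : Integrable (fun x : ℝ => δ / (δ ^ 2 + (x - ε) ^ 2)) μ := by
      refine Integrable.of_bound (C := δ / δ ^ 2)
        (by fun_prop : Measurable _).aestronglyMeasurable (Eventually.of_forall fun x => ?_)
      rw [Real.norm_of_nonneg (by positivity)]
      gcongr
      nlinarith [sq_nonneg (x - ε)]
    have h1 : μ.real {ε} * δ⁻¹ ≤ ∫ x, δ / (δ ^ 2 + (x - ε) ^ 2) ∂μ := by
      have : ∫ x in {ε}, δ / (δ ^ 2 + (x - ε) ^ 2) ∂μ ≤ ∫ x, δ / (δ ^ 2 + (x - ε) ^ 2) ∂μ :=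
        setIntegral_le_integral hb (Eventually.of_forall fun x => by positivity)
      refine le_trans (le_of_eq ?_) this
      rw [integral_singleton]
      simp only [sub_self, smul_eq_mul]
      field_simp
      simp
    have h2 : ∫ x, δ / (δ ^ 2 + (x - ε) ^ 2) ∂μ ≤ ∫ z in Ioi (0 : ℝ), ‖charFun μ z‖ := by
      rw [← integral_exp_neg_mul_re_charFun hδ]
      refine (le_abs_self _).trans (abs_integral_le_integral_abs.trans ?_)
      refine integral_mono_of_nonneg (Eventually.of_forall fun _ => abs_nonneg _) hF.norm ?_
      refine (ae_restrict_mem measurableSet_Ioi).mono fun z (hz : 0 < z) => ?_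
      simp only [abs_mul, Real.abs_exp]
      rw [← norm_exp_mul_charFun ε z, ← one_mul ‖_ * charFun μ z‖]
      gcongr
      · exact Real.exp_le_one_iff.2 (by nlinarith)
      · exact Complex.abs_re_le_norm _
    rw [← div_eq_mul_inv] at h1
    have := h1.trans h2
    rwa [div_le_iff₀ hδ, mul_comm] at this
  have hlim : Tendsto (fun δ : ℝ => δ * ∫ z in Ioi (0 : ℝ), ‖charFun μ z‖) (𝓝[>] 0) (𝓝 0) := by
    have : Tendsto (fun δ : ℝ => δ * ∫ z in Ioi (0 : ℝ), ‖charFun μ z‖) (𝓝 0)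
        (𝓝 (0 * ∫ z in Ioi (0 : ℝ), ‖charFun μ z‖)) := tendsto_id.mul_const _
    rw [zero_mul] at this
    exact this.mono_left nhdsWithin_le_nhds
  refine le_antisymm (ge_of_tendsto hlim ?_) measureReal_nonneg
  filter_upwards [self_mem_nhdsWithin] with δ hδ using hle δ hδ

theorem tendsto_arctan_div_sign (x : ℝ) :
    Tendsto (fun δ : ℝ => Real.arctan (x / δ)) (𝓝[>] 0) (𝓝 (Real.pi / 2 * Real.sign x)) := by
  rcases lt_trichotomy x 0 with hx | rfl | hx
  · rw [Real.sign_of_neg hx, mul_neg_one]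
    refine (Real.tendsto_arctan_atBot.mono_right nhdsWithin_le_nhds).comp ?_
    refine ((tendsto_inv_nhdsGT_zero (𝕜 := ℝ)).const_mul_atTop_of_neg hx).congr fun δ => ?_
    rw [div_eq_mul_inv]
  · simp
  · rw [Real.sign_of_pos hx, mul_one]
    refine (Real.tendsto_arctan_atTop.mono_right nhdsWithin_le_nhds).comp ?_
    refine ((tendsto_inv_nhdsGT_zero (𝕜 := ℝ)).const_mul_atTop hx).congr fun δ => ?_
    rw [div_eq_mul_inv]

/-- The Gil-Pelaez inversion formula, for a law with a first moment and an integrable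
characteristic function. -/
theorem measureReal_Ioi_eq_gilPelaez (hm : Integrable (fun x : ℝ => x) μ)
    (hF : IntegrableOn (charFun μ) (Ioi 0)) (ε : ℝ) :
    μ.real (Ioi ε) = 1 / 2 + 1 / Real.pi * ∫ z in Ioi (0 : ℝ),
      (Complex.exp (-Complex.I * z * ε) * charFun μ z).im / z := by
  have hint := integrableOn_im_exp_mul_charFun_div hm hF ε
  have hlim1 : Tendsto (fun δ : ℝ => ∫ z in Ioi (0 : ℝ), Real.exp (-δ * z) *
      ((Complex.exp (-Complex.I * z * ε) * charFun μ z).im / z)) (𝓝[>] 0)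
      (𝓝 (∫ z in Ioi (0 : ℝ), (Complex.exp (-Complex.I * z * ε) * charFun μ z).im / z)) := by
    refine tendsto_integral_filter_of_dominated_convergence
      (fun z => ‖(Complex.exp (-Complex.I * z * ε) * charFun μ z).im / z‖) ?_ ?_ hint.norm ?_
    · refine Eventually.of_forall fun δ => AEStronglyMeasurable.mul ?_ hint.aestronglyMeasurable
      exact (by fun_prop : Measurable _).aestronglyMeasurable
    · filter_upwards [self_mem_nhdsWithin] with δ (hδ : 0 < δ)
      refine (ae_restrict_mem measurableSet_Ioi).mono fun z (hz : 0 < z) => ?_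
      rw [norm_mul, Real.norm_eq_abs, Real.abs_exp]
      exact mul_le_of_le_one_left (norm_nonneg _) (Real.exp_le_one_iff.2 (by nlinarith))
    · refine Eventually.of_forall fun z => ?_
      have : Tendsto (fun δ : ℝ => Real.exp (-δ * z) *
          ((Complex.exp (-Complex.I * z * ε) * charFun μ z).im / z)) (𝓝 0)
          (𝓝 (Real.exp (-0 * z) *
          ((Complex.exp (-Complex.I * z * ε) * charFun μ z).im / z))) :=
        Continuous.tendsto (by fun_prop) 0
      simp only [neg_zero, zero_mul, Real.exp_zero, one_mul] at this
      exact this.mono_left nhdsWithin_le_nhds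
  have hlim2 : Tendsto (fun δ : ℝ => ∫ x, Real.arctan ((x - ε) / δ) ∂μ) (𝓝[>] 0)
      (𝓝 (∫ x, Real.pi / 2 * Real.sign (x - ε) ∂μ)) := by
    refine tendsto_integral_filter_of_dominated_convergence (fun _ => Real.pi / 2) ?_ ?_
      (integrable_const _) ?_
    · exact Eventually.of_forall fun δ => (by fun_prop : Measurable _).aestronglyMeasurable
    · refine Eventually.of_forall fun δ => Eventually.of_forall fun x => ?_
      exact abs_le.2 ⟨(Real.neg_pi_div_two_lt_arctan _).le, (Real.arctan_lt_pi_div_two _).le⟩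
    · exact Eventually.of_forall fun x => tendsto_arctan_div_sign _
  have heq := tendsto_nhds_unique hlim1 (hlim2.congr' (by
    filter_upwards [self_mem_nhdsWithin] with δ hδ
    exact (integral_exp_neg_mul_im_charFun hδ hm ε).symm))
  -- Since the sign vanishes at `0`, an atom at `ε` would contribute half of its mass; excluding it
  -- gives exactly `Ioi ε`.
  have hatom : ∀ᵐ x ∂μ, x ≠ ε := by
    have := measure_singleton_eq_zero_of_integrable_charFun hF ε
    rw [measureReal_eq_zero_iff] at this
    exact measure_eq_zero_iff_ae_notMem.1 this
  have hsign : ∫ x, Real.pi / 2 * Real.sign (x - ε) ∂μ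
      = Real.pi / 2 * (2 * μ.real (Ioi ε) - 1) := by
    rw [integral_const_mul]
    congr 1
    have h1 : ∫ x, Real.sign (x - ε) ∂μ
        = ∫ x, (2 * (Ioi ε).indicator (fun _ => (1 : ℝ)) x - 1) ∂μ := by
      refine integral_congr_ae (hatom.mono fun x hx => ?_)
      rcases lt_or_gt_of_ne hx with h | h
      · simp [Real.sign_of_neg (sub_neg.2 h), h.le]
      · simp only [Real.sign_of_pos (sub_pos.2 h), indicator_of_mem (mem_Ioi.2 h)]
        norm_num
    have hi : Integrable ((Ioi ε).indicator (fun _ => (1 : ℝ))) μ :=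
      (integrable_const 1).indicator measurableSet_Ioi
    rw [h1, integral_sub (hi.const_mul 2) (integrable_const 1), integral_const_mul,
      integral_indicator measurableSet_Ioi]
    simp
  rw [heq, hsign]
  have := Real.pi_ne_zero
  field_simp
  ring

end GilPelaez

/-! ### Moments and transforms of the Poisson and exponential laws -/

theorem lintegral_natCast_poissonMeasure (r : ℝ≥0) :
    ∫⁻ n, (n : ℝ≥0∞) ∂poissonMeasure r = r := by
  have h : HasSum (fun n : ℕ => Real.exp (-r) * r ^ n / n.factorial * n) (r : ℝ) := by
    -- The term `n = 0` vanishes; after the shift, `n + 1` cancels against the factorial and `r`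
    -- times the Poisson weights remains.
    rw [← hasSum_nat_add_iff' 1]
    have := (hasSum_one_poissonMeasure r).mul_left (r : ℝ)
    simp only [mul_one] at this
    simp only [Finset.range_one, Finset.sum_singleton, Nat.cast_zero, mul_zero, sub_zero]
    refine this.congr_fun fun n => ?_
    rw [Nat.factorial_succ]
    push_cast
    field_simp
    ring
  have h0 : ∀ n : ℕ, 0 ≤ Real.exp (-r) * r ^ n / n.factorial := fun n => by positivity
  rw [poissonMeasure, lintegral_sum_measure]
  simp_rw [lintegral_smul_measure, lintegral_dirac]
  calc ∑' n : ℕ, ENNReal.ofReal (Real.exp (-r) * r ^ n / n.factorial) • (n : ℝ≥0∞)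
      = ∑' n : ℕ, ENNReal.ofReal (Real.exp (-r) * r ^ n / n.factorial * n) := by
        congr with n
        rw [ENNReal.ofReal_mul (h0 n), ENNReal.ofReal_natCast, smul_eq_mul]
    _ = r := by
        rw [← ENNReal.ofReal_tsum_of_nonneg (fun n => mul_nonneg (h0 n) n.cast_nonneg) h.summable,
          h.tsum_eq, ENNReal.ofReal_coe_nnreal]

theorem integral_exp_mul_poissonMeasure (r : ℝ≥0) (c : ℂ) :
    ∫ n : ℕ, Complex.exp (-c * n) ∂poissonMeasure r = Complex.exp (r * (Complex.exp (-c) - 1)) := by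
  rw [integral_poissonMeasure]
  have h := (NormedSpace.expSeries_div_hasSum_exp ((r : ℂ) * Complex.exp (-c))).mul_left
    (Complex.exp (-r))
  rw [← Complex.exp_eq_exp_ℂ, ← Complex.exp_add] at h
  rw [show (r : ℂ) * (Complex.exp (-c) - 1) = -r + r * Complex.exp (-c) by ring, ← h.tsum_eq]
  congr with n
  rw [Complex.real_smul, mul_comm (-c), Complex.exp_nat_mul]
  push_cast
  rw [mul_pow]
  ring

section Exponential

theorem expMeasure_one_eq :
    expMeasure 1 = (volume.restrict (Ioi (0 : ℝ))).withDensity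
      (fun x => ENNReal.ofReal (Real.exp (-x))) := by
  rw [restrict_Ioi_eq_restrict_Ici, ← withDensity_indicator measurableSet_Ici]
  change volume.withDensity (exponentialPDF 1) = _
  congr 1
  ext x
  rw [exponentialPDF_eq]
  by_cases hx : 0 ≤ x
  · simp [hx]
  · simp [hx]

theorem integral_expMeasure_one (f : ℝ → ℂ) :
    ∫ x, f x ∂expMeasure 1 = ∫ x in Ioi (0 : ℝ), (Real.exp (-x)) • f x := by
  rw [expMeasure_one_eq, integral_withDensity_eq_integral_toReal_smul (by fun_prop) (by simp)]
  congr with x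
  rw [ENNReal.toReal_ofReal (Real.exp_pos _).le]

theorem ae_pos_expMeasure_one : ∀ᵐ x ∂expMeasure 1, 0 < x := by
  rw [expMeasure_one_eq]
  exact (withDensity_absolutelyContinuous _ _).ae_le (ae_restrict_mem measurableSet_Ioi)

theorem lintegral_ofReal_expMeasure_one : ∫⁻ x, ENNReal.ofReal x ∂expMeasure 1 = 1 := by
  rw [expMeasure_one_eq, lintegral_withDensity_eq_lintegral_mul _ (by fun_prop) (by fun_prop)]
  have h := Real.Gamma_eq_integral (s := 2) two_pos
  have hc := Real.GammaIntegral_convergent (s := 2) two_pos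
  rw [Real.Gamma_two] at h
  rw [← ENNReal.ofReal_one, h, ofReal_integral_eq_lintegral_ofReal hc]
  · refine setLIntegral_congr_fun measurableSet_Ioi fun x (hx : 0 < x) => ?_
    rw [Pi.mul_apply, ← ENNReal.ofReal_mul (Real.exp_pos _).le]
    norm_num
  · refine (ae_restrict_mem measurableSet_Ioi).mono fun x (hx : 0 < x) => ?_
    simp only [Pi.zero_apply]
    positivity

theorem integral_exp_I_mul_expMeasure_one (a : ℝ) :
    ∫ x : ℝ, Complex.exp (Complex.I * a * x) ∂expMeasure 1 = (1 - Complex.I * a)⁻¹ := by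
  rw [integral_expMeasure_one]
  have h := integral_exp_mul_complex_Ioi (a := -1 + Complex.I * a) (by simp) 0
  have h2 : ∀ x : ℝ, Real.exp (-x) • Complex.exp (Complex.I * a * x)
      = Complex.exp ((-1 + Complex.I * a) * x) := by
    intro x
    rw [Complex.real_smul, Complex.ofReal_exp, ← Complex.exp_add]
    congr 1
    push_cast
    ring
  simp_rw [h2, h]
  rw [Complex.ofReal_zero, mul_zero, Complex.exp_zero, neg_div, ← div_neg, one_div]
  congr 1
  ring

end Exponential

/-- On the convex half-plane `0 ≤ re` the derivative of `exp (-z)` has norm at most `1`. This makes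
the Laplace functional stable under `L¹` approximation. -/
theorem norm_exp_neg_sub_exp_neg_le {a b : ℂ} (ha : 0 ≤ a.re) (hb : 0 ≤ b.re) :
    ‖Complex.exp (-a) - Complex.exp (-b)‖ ≤ ‖a - b‖ := by
  have h := Convex.norm_image_sub_le_of_norm_hasDerivWithin_le
    (f := fun z : ℂ => Complex.exp (-z)) (f' := fun z => Complex.exp (-z) * -1)
    (s := {z : ℂ | 0 ≤ z.re}) (C := 1) (x := b) (y := a)
    (fun z _ => ((hasDerivAt_neg z).cexp).hasDerivWithinAt)
    (fun z hz => by
      rw [mul_neg_one, norm_neg, Complex.norm_exp]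
      simpa using hz)
    (convex_halfSpace_re_ge 0) hb ha
  simpa using h

/-! ### Campbell's formula and the Laplace functional -/

section PointProcess

variable {E Ω : Type*} [MeasurableSpace E] [MeasurableSpace Ω] {X : ℕ → Ω → E}
  {Λ : Measure E} {P : Measure Ω}

theorem toENNReal_pointCount {E Ω : Type*} (X : ℕ → Ω → E) (A : Set E) (ω : Ω) :
    ((pointCount X A ω : ℕ∞) : ℝ≥0∞) = ∑' n, A.indicator 1 (X n ω) := by
  rw [pointCount, ← ENNReal.tsum_set_one]
  exact tsum_subtype {n | X n ω ∈ A} (fun _ => (1 : ℝ≥0∞))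

theorem hasSum_indicator_of_pointCount_ne_top {E Ω : Type*} {X : ℕ → Ω → E} {A : Set E} {ω : Ω}
    (hA : pointCount X A ω ≠ ⊤) (c : ℂ) :
    HasSum (fun n => A.indicator (fun _ => c) (X n ω)) (c * (pointCount X A ω).toNat) := by
  have hfin : {n | X n ω ∈ A}.Finite := by
    rwa [pointCount, ne_eq, Set.encard_eq_top_iff, not_infinite] at hA
  have h := hasSum_sum_of_ne_finset_zero (f := fun n => A.indicator (fun _ => c) (X n ω))
    (s := hfin.toFinset) (L := .unconditional ℕ) (fun n hn => by
      have : X n ω ∉ A := by simpa using hn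
      simp [this])
  convert h using 1
  rw [Finset.sum_congr rfl (g := fun _ => c) (fun n hn => by
    have : X n ω ∈ A := by simpa using hn
    simp [this])]
  rw [Finset.sum_const, nsmul_eq_mul, mul_comm, pointCount, hfin.encard_eq_coe_toFinset_card]
  rfl

namespace IsPoissonPointProcess

theorem ae_pointCount_ne_top (hX : IsPoissonPointProcess X Λ P) {A : Set E}
    (hA : MeasurableSet A) (hΛ : Λ A ≠ ∞) : ∀ᵐ ω ∂P, pointCount X A ω ≠ ⊤ := by
  rw [(hX.count_hasLaw A hA hΛ).ae_iff (p := fun k => k ≠ ⊤) Measurable.of_discrete,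
    ae_map_iff Measurable.of_discrete.aemeasurable (MeasurableSet.of_discrete)]
  simp

theorem lintegral_pointCount (hX : IsPoissonPointProcess X Λ P) {A : Set E}
    (hA : MeasurableSet A) (hΛ : Λ A ≠ ∞) : ∫⁻ ω, pointCount X A ω ∂P = Λ A := by
  rw [(hX.count_hasLaw A hA hΛ).lintegral_comp (f := fun k : ℕ∞ => (k : ℝ≥0∞))
    Measurable.of_discrete.aemeasurable, lintegral_map Measurable.of_discrete
    Measurable.of_discrete]
  simp only [ENat.toENNReal_coe]
  rw [lintegral_natCast_poissonMeasure, ENNReal.coe_toNNReal hΛ]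

theorem integral_exp_pointCount (hX : IsPoissonPointProcess X Λ P) {A : Set E}
    (hA : MeasurableSet A) (hΛ : Λ A ≠ ∞) (c : ℂ) :
    ∫ ω, Complex.exp (-c * (pointCount X A ω).toNat) ∂P
      = Complex.exp (Λ.real A * (Complex.exp (-c) - 1)) := by
  refine ((hX.count_hasLaw A hA hΛ).integral_comp (f := fun k : ℕ∞ => Complex.exp (-c * k.toNat))
    StronglyMeasurable.of_discrete.aestronglyMeasurable).trans ?_
  rw [integral_map Measurable.of_discrete.aemeasurable
      StronglyMeasurable.of_discrete.aestronglyMeasurable]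
  simp only [ENat.toNat_natCast]
  exact integral_exp_mul_poissonMeasure _ _

/-- On sets of finite intensity this is the mean of the Poisson count; σ-finiteness extends it to
all measurable sets. -/
theorem sum_map_eq [SigmaFinite Λ] (hX : IsPoissonPointProcess X Λ P) :
    Measure.sum (fun n => P.map (X n)) = Λ := by
  have key : ∀ A, MeasurableSet A → Λ A ≠ ∞ → Measure.sum (fun n => P.map (X n)) A = Λ A := by
    intro A hA hΛ
    rw [← hX.lintegral_pointCount hA hΛ]
    simp_rw [toENNReal_pointCount]
    have hm : ∀ n, Measurable fun ω => A.indicator (1 : E → ℝ≥0∞) (X n ω) := fun n =>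
      (measurable_one.indicator hA).comp (hX.measurable_point n)
    rw [lintegral_tsum fun n => (hm n).aemeasurable, Measure.sum_apply _ hA]
    congr with n
    rw [Measure.map_apply (hX.measurable_point n) hA,
      ← lintegral_indicator_one (hX.measurable_point n hA)]
    rfl
  rw [Measure.ext_iff_of_iUnion_eq_univ (iUnion_spanningSets Λ)]
  intro i
  ext A hA
  rw [Measure.restrict_apply hA, Measure.restrict_apply hA]
  exact key _ (hA.inter (measurableSet_spanningSets Λ i))
    ((measure_mono inter_subset_right).trans_lt (measure_spanningSets_lt_top Λ i)).ne

/-- Campbell's formula. -/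
theorem tsum_lintegral [SigmaFinite Λ] (hX : IsPoissonPointProcess X Λ P) {f : E → ℝ≥0∞}
    (hf : Measurable f) : ∑' n, ∫⁻ ω, f (X n ω) ∂P = ∫⁻ x, f x ∂Λ := by
  rw [← hX.sum_map_eq, lintegral_sum_measure]
  congr with n
  rw [lintegral_map hf (hX.measurable_point n)]

theorem lintegral_tsum_comp [SigmaFinite Λ] (hX : IsPoissonPointProcess X Λ P) {f : E → ℝ≥0∞}
    (hf : Measurable f) : ∫⁻ ω, ∑' n, f (X n ω) ∂P = ∫⁻ x, f x ∂Λ := by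
  rw [← hX.tsum_lintegral hf]
  exact lintegral_tsum fun n => (hf.comp (hX.measurable_point n)).aemeasurable

theorem ae_summable_norm [SigmaFinite Λ] (hX : IsPoissonPointProcess X Λ P) {g : E → ℂ}
    (hg : Measurable g) (hi : Integrable g Λ) : ∀ᵐ ω ∂P, Summable fun n => ‖g (X n ω)‖ := by
  have hfin : ∫⁻ ω, ∑' n, ‖g (X n ω)‖ₑ ∂P ≠ ∞ := by
    rw [hX.lintegral_tsum_comp hg.enorm]
    exact hi.2.ne
  have hm : Measurable fun ω => ∑' n, ‖g (X n ω)‖ₑ :=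
    Measurable.tsum fun n => (hg.comp (hX.measurable_point n)).enorm
  refine (ae_lt_top hm hfin).mono fun ω hω => ?_
  have := ENNReal.summable_toReal hω.ne
  simpa using this

theorem aestronglyMeasurable_tsum [SigmaFinite Λ] (hX : IsPoissonPointProcess X Λ P) {g : E → ℂ}
    (hg : Measurable g) (hi : Integrable g Λ) :
    AEStronglyMeasurable (fun ω => ∑' n, g (X n ω)) P := by
  refine aestronglyMeasurable_of_tendsto_ae atTop
    (f := fun N ω => ∑ n ∈ Finset.range N, g (X n ω)) (fun N => ?_) ?_
  · exact (Finset.measurable_sum _ fun n _ =>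
      hg.comp (hX.measurable_point n)).aestronglyMeasurable
  · exact (hX.ae_summable_norm hg hi).mono fun ω hω => hω.of_norm.hasSum.tendsto_sum_nat

theorem integrable_exp_neg_tsum [IsProbabilityMeasure P] [SigmaFinite Λ]
    (hX : IsPoissonPointProcess X Λ P) {g : E → ℂ}
    (hg : Measurable g) (hi : Integrable g Λ) (hre : ∀ x, 0 ≤ (g x).re) :
    Integrable (fun ω => Complex.exp (-∑' n, g (X n ω))) P := by
  refine Integrable.of_bound (C := 1)
    (Complex.continuous_exp.comp_aestronglyMeasurable (hX.aestronglyMeasurable_tsum hg hi).neg) ?_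
  refine (hX.ae_summable_norm hg hi).mono fun ω hω => ?_
  rw [Complex.norm_exp, Complex.neg_re, Complex.re_tsum hω.of_norm]
  simpa using tsum_nonneg fun n => hre (X n ω)

/-- The exponential factors over the disjoint sets, whose counts are independent, so the expectation
is a product of Poisson transforms. -/
theorem integral_exp_neg_tsum_sum [IsProbabilityMeasure P]
    (hX : IsPoissonPointProcess X Λ P) {m : ℕ} (A : Fin m → Set E) (c : Fin m → ℂ)
    (hA : ∀ i, MeasurableSet (A i)) (hΛ : ∀ i, Λ (A i) ≠ ∞)
    (hd : Pairwise fun i j => Disjoint (A i) (A j)) :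
    ∫ ω, Complex.exp (-∑' n, ∑ i, (A i).indicator (fun _ => c i) (X n ω)) ∂P
      = Complex.exp (∫ x, ∑ i, (A i).indicator (fun _ => Complex.exp (-c i) - 1) x ∂Λ) := by
  have h1 : ∀ᵐ ω ∂P, Complex.exp (-∑' n, ∑ i, (A i).indicator (fun _ => c i) (X n ω))
      = ∏ i, Complex.exp (-c i * (pointCount X (A i) ω).toNat) := by
    filter_upwards [ae_all_iff.2 fun i => hX.ae_pointCount_ne_top (hA i) (hΛ i)] with ω hω
    rw [(hasSum_sum fun i _ => hasSum_indicator_of_pointCount_ne_top (hω i) (c i)).tsum_eq,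
      ← Complex.exp_sum, ← Finset.sum_neg_distrib]
    simp_rw [neg_mul]
  have hind := (hX.count_indep m A hA hd).comp
    (fun i (k : ℕ∞) => Complex.exp (-c i * k.toNat)) (fun i => Measurable.of_discrete)
  rw [integral_congr_ae h1]
  refine (iIndepFun.integral_fun_prod_eq_prod_integral hind ?_).trans ?_
  rotate_left
  · rw [integral_finsetSum, Complex.exp_sum]
    · refine Finset.prod_congr rfl fun i _ => ?_
      rw [integral_indicator (hA i), setIntegral_const, Complex.real_smul]
      exact hX.integral_exp_pointCount (hA i) (hΛ i) (c i)
    · exact fun i _ => (integrable_indicator_iff (hA i)).2 (integrableOn_const (hΛ i))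
  · intro i
    exact ((Measurable.of_discrete (f := fun k : ℕ∞ =>
      Complex.exp (-c i * k.toNat))).comp_aemeasurable
      (hX.count_hasLaw (A i) (hA i) (hΛ i)).aemeasurable).aestronglyMeasurable

theorem integral_exp_neg_tsum_simpleFunc [IsProbabilityMeasure P]
    (hX : IsPoissonPointProcess X Λ P) (g : SimpleFunc E ℂ) (hi : Integrable g Λ) :
    ∫ ω, Complex.exp (-∑' n, g (X n ω)) ∂P
      = Complex.exp (∫ x, (Complex.exp (-g x) - 1) ∂Λ) := by
  classical
  -- The zero fibre may have infinite intensity, but it contributes to neither side; the other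
  -- fibres have finite intensity by integrability.
  set s : Finset ℂ := g.range.erase 0 with hs
  set e := s.equivFin with he
  let c : Fin s.card → ℂ := fun i => e.symm i
  let A : Fin s.card → Set E := fun i => g ⁻¹' {c i}
  have hc : Function.Injective c := Subtype.val_injective.comp e.symm.injective
  have hc0 : ∀ i, c i ≠ 0 := fun i => Finset.ne_of_mem_erase (e.symm i).2
  have hsum : ∀ (F : ℂ → ℂ), F 0 = 0 → ∀ x,
      F (g x) = ∑ i, (A i).indicator (fun _ => F (c i)) x := by
    intro F hF x
    have h1 : ∀ i, (A i).indicator (fun _ => F (c i)) x = if g x = c i then F (c i) else 0 := by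
      intro i
      simp [A, indicator_apply]
    simp_rw [h1]
    by_cases hx : g x = 0
    · rw [hx, hF, Finset.sum_eq_zero]
      intro i _
      rw [if_neg (hc0 i).symm]
    · have hmem : g x ∈ s := Finset.mem_erase.2 ⟨hx, g.mem_range_self x⟩
      have hci : c (e ⟨g x, hmem⟩) = g x := by simp [c]
      rw [Finset.sum_eq_single (e ⟨g x, hmem⟩)]
      · rw [hci, if_pos rfl]
      · intro i _ hne
        rw [if_neg]
        intro h
        exact hne (hc (h.symm.trans hci.symm))
      · simp
  have h := hX.integral_exp_neg_tsum_sum A c (fun i => g.measurableSet_fiber _)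
    (fun i => (SimpleFunc.integrable_iff.1 hi (c i) (hc0 i)).ne)
    (fun i j hij => Disjoint.preimage _ (by simpa using hc.ne hij))
  have h1 : ∀ x, ∑ i, (A i).indicator (fun _ => c i) x = g x := fun x =>
    (hsum (fun y => y) rfl x).symm
  have h2 : ∀ x, ∑ i, (A i).indicator (fun _ => Complex.exp (-c i) - 1) x
      = Complex.exp (-g x) - 1 := fun x =>
    (hsum (fun y => Complex.exp (-y) - 1) (by simp) x).symm
  simp_rw [h1, h2] at h
  exact h

/-- The Laplace functional of a Poisson point process. -/
theorem integral_exp_neg_tsum [IsProbabilityMeasure P] [SigmaFinite Λ]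
    (hX : IsPoissonPointProcess X Λ P) {g : E → ℂ}
    (hg : Measurable g) (hi : Integrable g Λ) (hre : ∀ x, 0 ≤ (g x).re) :
    ∫ ω, Complex.exp (-∑' n, g (X n ω)) ∂P
      = Complex.exp (∫ x, (Complex.exp (-g x) - 1) ∂Λ) := by
  let s : Set ℂ := {z | 0 ≤ z.re}
  have h0 : (0 : ℂ) ∈ s := by simp [s]
  -- The approximants take values in the half-plane itself, so the Lipschitz bound for `exp (-z)`
  -- applies to them as well.
  let G : ℕ → SimpleFunc E ℂ := fun k => SimpleFunc.approxOn g hg s 0 h0 k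
  have hGre : ∀ k x, 0 ≤ (G k x).re := fun k x => SimpleFunc.approxOn_mem hg h0 k x
  have hGi : ∀ k, Integrable (G k) Λ := fun k =>
    SimpleFunc.integrable_approxOn hg hi h0 (integrable_zero _ _ _) k
  have hGlim : Tendsto (fun k => ∫⁻ x, ‖G k x - g x‖ₑ ∂Λ) atTop (𝓝 0) :=
    SimpleFunc.tendsto_approxOn_L1_enorm hg h0
      (Eventually.of_forall fun x => subset_closure (hre x)) (by simpa only [sub_zero] using hi.2)
  have hexp : ∀ f : E → ℂ, Measurable f → Integrable f Λ → (∀ x, 0 ≤ (f x).re) →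
      Integrable (fun x => Complex.exp (-f x) - 1) Λ := by
    intro f hf hfi hfre
    refine hfi.norm.mono' (by fun_prop : Measurable _).aestronglyMeasurable
      (Eventually.of_forall fun x => ?_)
    simpa using norm_exp_neg_sub_exp_neg_le (hfre x) (b := 0) le_rfl
  have hL : Tendsto (fun k => ∫ ω, Complex.exp (-∑' n, G k (X n ω)) ∂P) atTop
      (𝓝 (∫ ω, Complex.exp (-∑' n, g (X n ω)) ∂P)) := by
    refine tendsto_integral_of_L1 _ (hX.integrable_exp_neg_tsum hg hi hre).1
      (Eventually.of_forall fun k =>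
        hX.integrable_exp_neg_tsum (G k).measurable (hGi k) (hGre k)) ?_
    refine tendsto_of_tendsto_of_tendsto_of_le_of_le tendsto_const_nhds hGlim
      (fun _ => zero_le) fun k => ?_
    -- Campbell's formula bounds the `L¹(P)` distance of the exponentials by the `L¹(Λ)` distance of
    -- `G k` and `g`.
    refine le_trans (lintegral_mono_ae ?_)
      (hX.lintegral_tsum_comp (((G k).measurable.sub hg).enorm)).le
    filter_upwards [hX.ae_summable_norm hg hi,
      hX.ae_summable_norm (G k).measurable (hGi k)] with ω h1 h2
    have hsub : Summable fun n => ‖G k (X n ω) - g (X n ω)‖ :=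
      Summable.of_nonneg_of_le (fun _ => norm_nonneg _) (fun _ => norm_sub_le _ _) (h2.add h1)
    calc ‖Complex.exp (-∑' n, G k (X n ω)) - Complex.exp (-∑' n, g (X n ω))‖ₑ
        ≤ ‖∑' n, G k (X n ω) - ∑' n, g (X n ω)‖ₑ := by
          rw [enorm_le_iff_norm_le]
          refine norm_exp_neg_sub_exp_neg_le ?_ ?_
          · rw [Complex.re_tsum h2.of_norm]
            exact tsum_nonneg fun n => hGre k _
          · rw [Complex.re_tsum h1.of_norm]
            exact tsum_nonneg fun n => hre _
      _ = ‖∑' n, (G k (X n ω) - g (X n ω))‖ₑ := by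
          rw [h2.of_norm.tsum_sub h1.of_norm]
      _ ≤ ∑' n, ‖G k (X n ω) - g (X n ω)‖ₑ := enorm_tsum_le_tsum_enorm
  have hR : Tendsto (fun k => Complex.exp (∫ x, (Complex.exp (-G k x) - 1) ∂Λ)) atTop
      (𝓝 (Complex.exp (∫ x, (Complex.exp (-g x) - 1) ∂Λ))) := by
    refine (Complex.continuous_exp.tendsto _).comp ?_
    refine tendsto_integral_of_L1 _ (hexp g hg hi hre).1
      (Eventually.of_forall fun k => hexp _ (G k).measurable (hGi k) (hGre k)) ?_
    refine tendsto_of_tendsto_of_tendsto_of_le_of_le tendsto_const_nhds hGlim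
      (fun _ => zero_le) fun k => lintegral_mono fun x => ?_
    rw [sub_sub_sub_cancel_right, enorm_le_iff_norm_le]
    exact norm_exp_neg_sub_exp_neg_le (hGre k x) (hre x)
  refine tendsto_nhds_unique hL (hR.congr fun k => ?_)
  exact (hX.integral_exp_neg_tsum_simpleFunc (G k) (hGi k)).symm

end IsPoissonPointProcess

end PointProcess

/-! ### Shot noise with exponential marks -/

theorem one_le_norm_one_sub_I_mul (a : ℝ) : 1 ≤ ‖1 - Complex.I * a‖ := by
  simpa using Complex.re_le_norm (1 - Complex.I * a)

theorem one_sub_I_mul_ne_zero (a : ℝ) : 1 - Complex.I * a ≠ 0 :=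
  norm_pos_iff.1 (zero_lt_one.trans_le (one_le_norm_one_sub_I_mul a))

theorem re_log_one_sub_I_mul_nonneg (a : ℝ) : 0 ≤ (Complex.log (1 - Complex.I * a)).re := by
  rw [Complex.log_re]
  exact Real.log_nonneg (one_le_norm_one_sub_I_mul a)

/-- The derivative of `log (1 - i t)` has norm `1 / ‖1 - i t‖ ≤ 1`. The bound passes integrability
from the response to its logarithmic transform. -/
theorem norm_log_one_sub_I_mul_le (a : ℝ) : ‖Complex.log (1 - Complex.I * a)‖ ≤ |a| := by
  have hd : ∀ t : ℝ, HasDerivAt (fun t : ℝ => Complex.log (1 - Complex.I * t))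
      (-(Complex.I * 1) / (1 - Complex.I * t)) t := fun t =>
    ((((hasDerivAt_id t).ofReal_comp).const_mul Complex.I).const_sub 1).clog_real
      (Or.inl (by simp))
  have h := Convex.norm_image_sub_le_of_norm_hasDerivWithin_le (s := univ) (C := 1)
    (x := (0 : ℝ)) (y := a) (fun t _ => (hd t).hasDerivWithinAt)
    (fun t _ => by
      rw [norm_div, mul_one, norm_neg, Complex.norm_I]
      exact (div_le_one (zero_lt_one.trans_le (one_le_norm_one_sub_I_mul t))).2
        (one_le_norm_one_sub_I_mul t)) convex_univ trivial trivial
  simpa using h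

/-- The sum of the marks `h n ω`, weighted by the response `f` at the points `X n ω`. -/
noncomputable def shotNoise {E Ω : Type*} (X : ℕ → Ω → E) (h : ℕ → Ω → ℝ) (f : E → ℝ) (ω : Ω) : ℝ≥0∞ :=
  ∑' n, ENNReal.ofReal (h n ω) * ENNReal.ofReal (f (X n ω))

theorem hasSum_toReal_shotNoise {E Ω : Type*} {X : ℕ → Ω → E} {h : ℕ → Ω → ℝ}
    {f : E → ℝ} (hf0 : ∀ x, 0 ≤ f x) {ω : Ω} (hpos : ∀ n, 0 ≤ h n ω)
    (hfin : shotNoise X h f ω ≠ ∞) :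
    HasSum (fun n => h n ω * f (X n ω)) (shotNoise X h f ω).toReal := by
  have := ENNReal.hasSum_toReal hfin
  rw [shotNoise, ENNReal.tsum_toReal_eq (ENNReal.ne_top_of_tsum_ne_top hfin)]
  simpa only [ENNReal.toReal_mul, ENNReal.toReal_ofReal (hpos _),
    ENNReal.toReal_ofReal (hf0 _)] using this

section ShotNoise

variable {E Ω : Type*} [MeasurableSpace E] [MeasurableSpace Ω] {X : ℕ → Ω → E}
  {Λ : Measure E} {P : Measure Ω} {h : ℕ → Ω → ℝ} {f : E → ℝ}

theorem measurable_shotNoise (hX : IsPoissonPointProcess X Λ P) (hh : HasIndepExpMarks X h P)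
    (hf : Measurable f) : Measurable (shotNoise X h f) :=
  Measurable.tsum fun n => ((hh.measurable_mark n).ennreal_ofReal).mul
    ((hf.comp (hX.measurable_point n)).ennreal_ofReal)

theorem lintegral_shotNoise [SigmaFinite Λ] (hX : IsPoissonPointProcess X Λ P)
    (hh : HasIndepExpMarks X h P) (hf : Measurable f) :
    ∫⁻ ω, shotNoise X h f ω ∂P = ∫⁻ x, ENNReal.ofReal (f x) ∂Λ := by
  have hmh : ∀ n, Measurable fun ω => ENNReal.ofReal (h n ω) :=
    fun n => (hh.measurable_mark n).ennreal_ofReal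
  have hmf : ∀ n, Measurable fun ω => ENNReal.ofReal (f (X n ω)) :=
    fun n => (hf.comp (hX.measurable_point n)).ennreal_ofReal
  rw [← hX.tsum_lintegral hf.ennreal_ofReal]
  refine (lintegral_tsum fun n => ((hmh n).mul (hmf n)).aemeasurable).trans ?_
  congr with n
  have hind : IndepFun (fun ω => ENNReal.ofReal (h n ω)) (fun ω => ENNReal.ofReal (f (X n ω))) P :=
    hh.mark_indep_point.comp (φ := fun y : ℕ → ℝ => ENNReal.ofReal (y n))
      (ψ := fun x : ℕ → E => ENNReal.ofReal (f (x n)))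
      (measurable_pi_apply n).ennreal_ofReal (hf.comp (measurable_pi_apply n)).ennreal_ofReal
  have h1 : ∫⁻ ω, ENNReal.ofReal (h n ω) ∂P = 1 := by
    rw [(hh.mark_hasLaw n).lintegral_comp (f := ENNReal.ofReal)
      ENNReal.measurable_ofReal.aemeasurable, lintegral_ofReal_expMeasure_one]
  refine (lintegral_mul_eq_lintegral_mul_lintegral_of_indepFun (hmh n) (hmf n) hind).trans ?_
  rw [h1, one_mul]

theorem ae_shotNoise_ne_top [SigmaFinite Λ] (hX : IsPoissonPointProcess X Λ P)
    (hh : HasIndepExpMarks X h P) (hf : Measurable f) (hi : Integrable f Λ) :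
    ∀ᵐ ω ∂P, shotNoise X h f ω ≠ ∞ := by
  have : ∫⁻ ω, shotNoise X h f ω ∂P ≠ ∞ := by
    rw [lintegral_shotNoise hX hh hf]
    exact hi.lintegral_lt_top.ne
  exact (ae_lt_top (measurable_shotNoise hX hh hf) this).mono fun ω hω => hω.ne

theorem integrable_toReal_shotNoise [SigmaFinite Λ] (hX : IsPoissonPointProcess X Λ P)
    (hh : HasIndepExpMarks X h P) (hf : Measurable f) (hi : Integrable f Λ) :
    Integrable (fun ω => (shotNoise X h f ω).toReal) P := by
  refine integrable_toReal_of_lintegral_ne_top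
    (measurable_shotNoise hX hh hf).aemeasurable ?_
  rw [lintegral_shotNoise hX hh hf]
  exact hi.lintegral_lt_top.ne

/-- The joint law of marks and points is a product measure. With the points frozen, the factors are
independent and each averages to the transform of `Exp(1)`. -/
theorem integral_prod_exp_mark [IsProbabilityMeasure P] (hX : IsPoissonPointProcess X Λ P)
    (hh : HasIndepExpMarks X h P) (hf : Measurable f) (N : ℕ) :
    ∫ ω, ∏ n : Fin N, Complex.exp (Complex.I * f (X n ω) * h n ω) ∂P
      = ∫ ω, ∏ n : Fin N, (1 - Complex.I * f (X n ω))⁻¹ ∂P := by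
  have hmh : Measurable fun ω n => h n ω := measurable_pi_lambda _ hh.measurable_mark
  have hmX : Measurable fun ω n => X n ω := measurable_pi_lambda _ hX.measurable_point
  let G : (ℕ → ℝ) × (ℕ → E) → ℂ := fun p =>
    ∏ n : Fin N, Complex.exp (Complex.I * f (p.2 n) * p.1 n)
  have hG : Measurable G := by
    refine Finset.measurable_prod _ fun n _ => ?_
    have h1 : Measurable fun p : (ℕ → ℝ) × (ℕ → E) => f (p.2 n) :=
      hf.comp ((measurable_pi_apply _).comp measurable_snd)
    have h2 : Measurable fun p : (ℕ → ℝ) × (ℕ → E) => p.1 n :=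
      (measurable_pi_apply _).comp measurable_fst
    fun_prop
  have hGn : ∀ p, ‖G p‖ ≤ 1 := by
    intro p
    simp only [G, norm_prod]
    refine Finset.prod_le_one (fun _ _ => norm_nonneg _) fun n _ => ?_
    rw [Complex.norm_exp]
    simp
  have hpm := hh.mark_indep_point.map_prod_eq_prod_map_map hmh.aemeasurable hmX.aemeasurable
  have hp1 : IsProbabilityMeasure (P.map fun ω n => h n ω) :=
    Measure.isProbabilityMeasure_map hmh.aemeasurable
  have hp2 : IsProbabilityMeasure (P.map fun ω n => X n ω) :=
    Measure.isProbabilityMeasure_map hmX.aemeasurable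
  calc ∫ ω, ∏ n : Fin N, Complex.exp (Complex.I * f (X n ω) * h n ω) ∂P
      = ∫ p, G p ∂(P.map fun ω => ((fun n => h n ω), (fun n => X n ω))) :=
        (integral_map (hmh.prodMk hmX).aemeasurable hG.aestronglyMeasurable).symm
    _ = ∫ x, ∫ y, G (y, x) ∂(P.map fun ω n => h n ω) ∂(P.map fun ω n => X n ω) := by
        rw [hpm]
        exact integral_prod_symm G (Integrable.of_bound hG.aestronglyMeasurable 1
          (Eventually.of_forall hGn))
    _ = ∫ x : ℕ → E, ∏ n : Fin N, (1 - Complex.I * f (x n))⁻¹ ∂(P.map fun ω n => X n ω) := by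
        congr with x
        refine (integral_map hmh.aemeasurable
          (hG.comp measurable_prodMk_right).aestronglyMeasurable).trans ?_
        have hind := (hh.mark_indep.precomp (g := fun n : Fin N => (n : ℕ))
          Fin.val_injective).comp
          (fun n (y : ℝ) => Complex.exp (Complex.I * f (x n) * y)) (fun n => by fun_prop)
        refine (iIndepFun.integral_fun_prod_eq_prod_integral hind fun n => ?_).trans ?_
        · exact ((by fun_prop : Measurable fun y : ℝ =>
            Complex.exp (Complex.I * f (x n) * y)).comp
            (hh.measurable_mark n)).aestronglyMeasurable
        · refine Finset.prod_congr rfl fun n _ => ?_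
          rw [← integral_exp_I_mul_expMeasure_one]
          exact (hh.mark_hasLaw n).integral_comp
            (f := fun y : ℝ => Complex.exp (Complex.I * f (x n) * y))
            (by fun_prop : Measurable _).aestronglyMeasurable
    _ = ∫ ω, ∏ n : Fin N, (1 - Complex.I * f (X n ω))⁻¹ ∂P := by
        refine integral_map hmX.aemeasurable (Measurable.aestronglyMeasurable ?_)
        refine Finset.measurable_prod _ fun n _ => ?_
        have h1 : Measurable fun p : ℕ → E => f (p n) := hf.comp (measurable_pi_apply _)
        fun_prop

/-- Both expectations are limits of those of the partial products in `integral_prod_exp_mark`, whose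
integrands are bounded by `1`. -/
theorem integral_exp_shotNoise [IsProbabilityMeasure P] [SigmaFinite Λ]
    (hX : IsPoissonPointProcess X Λ P) (hh : HasIndepExpMarks X h P)
    (hf : Measurable f) (hi : Integrable f Λ) (hf0 : ∀ x, 0 ≤ f x) (z : ℝ) :
    ∫ ω, Complex.exp (Complex.I * z * (shotNoise X h f ω).toReal) ∂P
      = Complex.exp (∫ x, ((1 - Complex.I * (z * f x : ℝ))⁻¹ - 1) ∂Λ) := by
  have hzf : Measurable fun x => z * f x := hf.const_mul z
  -- Chosen so that `exp (-g)` is the mark-averaged factor.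
  let g : E → ℂ := fun x => Complex.log (1 - Complex.I * (z * f x : ℝ))
  have hg : Measurable g := by fun_prop
  have hgi : Integrable g Λ :=
    (hi.const_mul z).norm.mono' hg.aestronglyMeasurable
      (Eventually.of_forall fun x => norm_log_one_sub_I_mul_le _)
  have hgexp : ∀ x, Complex.exp (-g x) = (1 - Complex.I * (z * f x : ℝ))⁻¹ := fun x => by
    rw [Complex.exp_neg, Complex.exp_log (one_sub_I_mul_ne_zero _)]
  have hlap := hX.integral_exp_neg_tsum hg hgi fun x => re_log_one_sub_I_mul_nonneg _
  simp_rw [hgexp] at hlap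
  rw [← hlap]
  have hpos : ∀ᵐ ω ∂P, ∀ n, 0 ≤ h n ω := by
    refine ae_all_iff.2 fun n => ?_
    refine ((hh.mark_hasLaw n).ae_iff (p := fun y => 0 ≤ y) ?_).2
      (ae_pos_expMeasure_one.mono fun x hx => hx.le)
    exact measurableSet_setOfPred.1 measurableSet_Ici
  have hL : Tendsto (fun N : ℕ => ∫ ω, ∏ n : Fin N,
      Complex.exp (Complex.I * (z * f (X n ω) : ℝ) * h n ω) ∂P) atTop
      (𝓝 (∫ ω, Complex.exp (Complex.I * z * (shotNoise X h f ω).toReal) ∂P)) := by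
    refine tendsto_integral_of_dominated_convergence (fun _ => 1) (fun N => ?_)
      (integrable_const 1) (fun N => Eventually.of_forall fun ω => ?_) ?_
    · refine (Finset.measurable_prod _ fun n _ => ?_).aestronglyMeasurable
      have h1 := hX.measurable_point n
      have h2 := hh.measurable_mark n
      fun_prop
    · rw [norm_prod]
      refine Finset.prod_le_one (fun _ _ => norm_nonneg _) fun n _ => ?_
      rw [Complex.norm_exp]
      simp
    · filter_upwards [hpos, ae_shotNoise_ne_top hX hh hf hi] with ω h1 h2
      have hs := (hasSum_toReal_shotNoise hf0 h1 h2).tendsto_sum_nat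
      have hc : Continuous fun s : ℝ => Complex.exp (Complex.I * z * s) := by fun_prop
      refine ((hc.tendsto _).comp hs).congr fun N => ?_
      simp only [Function.comp_def]
      rw [← Complex.exp_sum, Finset.sum_range, Complex.ofReal_sum, Finset.mul_sum]
      congr 1
      refine Finset.sum_congr rfl fun n _ => ?_
      push_cast
      ring
  have hR : Tendsto (fun N : ℕ => ∫ ω, ∏ n : Fin N,
      (1 - Complex.I * (z * f (X n ω) : ℝ))⁻¹ ∂P) atTop
      (𝓝 (∫ ω, Complex.exp (-∑' n, g (X n ω)) ∂P)) := by
    refine tendsto_integral_of_dominated_convergence (fun _ => 1) (fun N => ?_)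
      (integrable_const 1) (fun N => Eventually.of_forall fun ω => ?_) ?_
    · refine (Finset.measurable_prod _ fun n _ => ?_).aestronglyMeasurable
      have h1 := hX.measurable_point n
      fun_prop
    · rw [norm_prod]
      refine Finset.prod_le_one (fun _ _ => norm_nonneg _) fun n _ => ?_
      rw [norm_inv]
      exact inv_le_one_of_one_le₀ (one_le_norm_one_sub_I_mul _)
    · filter_upwards [hX.ae_summable_norm hg hgi] with ω h1
      have hs := h1.of_norm.hasSum.tendsto_sum_nat
      refine ((Complex.continuous_exp.tendsto _).comp hs.neg).congr fun N => ?_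
      simp only [Function.comp_def]
      rw [← Finset.sum_neg_distrib, Complex.exp_sum, Finset.prod_range]
      exact Finset.prod_congr rfl fun n _ => hgexp _
  exact tendsto_nhds_unique hL (hR.congr fun N =>
    (integral_prod_exp_mark hX hh hzf N).symm)

end ShotNoise

/-! ### The overlap function and the harvested energy as shot noise -/

section Overlap

variable {TI TE : ℝ}

theorem overlap_nonneg (hTI : 0 < TI) (hTE : 0 < TE) (t : ℝ) : 0 ≤ overlap TI TE t := by
  unfold overlap
  grind

theorem overlap_le (hTI : 0 < TI) (t : ℝ) : overlap TI TE t ≤ TI := by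
  unfold overlap
  grind

theorem overlap_eq_zero_of_notMem (hTI : 0 < TI) (hTE : 0 < TE) {t : ℝ}
    (ht : t ∉ Ioc (-TI) TE) : overlap TI TE t = 0 := by
  rw [mem_Ioc] at ht
  unfold overlap
  grind

/-- Supplies a fixed window of starting times, of length `TI / 2`, for the decay estimate
`norm_energyCharFun_le`. -/
theorem half_min_le_overlap (hTI : 0 < TI) (hTE : 0 < TE) {t : ℝ}
    (ht : t ∈ Icc (-(TI / 2)) 0) : min TI TE / 2 ≤ overlap TI TE t := by
  obtain ⟨h1, h2⟩ := ht
  unfold overlap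
  grind

theorem measurable_overlap (TI TE : ℝ) : Measurable (overlap TI TE) := by
  unfold overlap
  refine Measurable.ite measurableSet_Iic measurable_const ?_
  refine Measurable.ite measurableSet_Iic (by fun_prop) ?_
  refine Measurable.ite measurableSet_Iic measurable_const ?_
  exact Measurable.ite measurableSet_Iio (by fun_prop) measurable_const

theorem integrable_overlap (hTI : 0 < TI) (hTE : 0 < TE) : Integrable (overlap TI TE) := by
  have h : IntegrableOn (overlap TI TE) (Ioc (-TI) TE) := by
    refine Measure.integrableOn_of_bounded (M := TI) (by simp)
      (measurable_overlap TI TE).aestronglyMeasurable (Eventually.of_forall fun t => ?_)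
    rw [Real.norm_of_nonneg (overlap_nonneg hTI hTE t)]
    exact overlap_le hTI t
  rwa [integrableOn_iff_integrable_of_support_subset] at h
  exact fun t ht => by_contra fun hn => ht (overlap_eq_zero_of_notMem hTI hTE hn)

theorem measurable_active (TI s : ℝ) : Measurable fun t => active TI t s :=
  measurable_const.indicator measurableSet_Icc

theorem active_nonneg (TI t s : ℝ) : 0 ≤ active TI t s :=
  indicator_nonneg (fun _ _ => zero_le_one) t

theorem lintegral_active (hTI : 0 < TI) (hTE : 0 < TE) (s : ℝ) :
    ∫⁻ t in Icc 0 TE, ENNReal.ofReal (active TI t s) = ENNReal.ofReal (overlap TI TE s) := by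
  rw [overlap_eq_integral hTI hTE, intervalIntegral.integral_of_le hTE.le,
    ← integral_Icc_eq_integral_Ioc, ofReal_integral_eq_lintegral_ofReal]
  · exact ((integrable_const (1 : ℝ)).indicator measurableSet_Icc)
  · exact Eventually.of_forall fun t => active_nonneg TI t s

end Overlap

/-- The mean energy harvested from a transmitter at a given place and starting time. -/
noncomputable def meanEnergy (P₁ α TI TE : ℝ) (p : Plane × ℝ) : ℝ :=
  (1 + ‖p.1‖ ^ α)⁻¹ * (P₁ * overlap TI TE p.2)

/-- Tonelli exchanges time integral and sum. The identity holds for every `ω`: a negative mark is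
truncated to `0` on both sides. -/
theorem harvestedEnergy_eq_shotNoise {Ω : Type*} {P₁ α TI TE : ℝ} (hP : 0 < P₁) (hTI : 0 < TI)
    (hTE : 0 < TE) (X : ℕ → Ω → Plane × ℝ) (h : ℕ → Ω → ℝ) (ω : Ω) :
    harvestedEnergy P₁ α TI TE X h ω = shotNoise X h (meanEnergy P₁ α TI TE) ω := by
  have hg : ∀ x : Plane, 0 ≤ (1 + ‖x‖ ^ α)⁻¹ := fun x => by positivity
  unfold harvestedEnergy incidentPower shotNoise meanEnergy
  have hsplit : ∀ t n, ENNReal.ofReal (active TI t (X n ω).2 * h n ω * (1 + ‖(X n ω).1‖ ^ α)⁻¹)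
      = ENNReal.ofReal (active TI t (X n ω).2) *
        (ENNReal.ofReal (h n ω) * ENNReal.ofReal ((1 + ‖(X n ω).1‖ ^ α)⁻¹)) := by
    intro t n
    rw [mul_assoc, ENNReal.ofReal_mul (active_nonneg _ _ _), ENNReal.ofReal_mul' (hg _)]
  have hm : ∀ n, Measurable fun t => ENNReal.ofReal (active TI t (X n ω).2) := fun n =>
    (measurable_active TI _).ennreal_ofReal
  simp_rw [hsplit]
  rw [lintegral_const_mul _ (Measurable.tsum fun n => (hm n).mul_const _),
    lintegral_tsum fun n => ((hm n).mul_const _).aemeasurable, ← ENNReal.tsum_mul_left]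
  congr with n
  rw [lintegral_mul_const _ (hm n), lintegral_active hTI hTE, ENNReal.ofReal_mul (hg _),
    ENNReal.ofReal_mul hP.le]
  ring

/-! ### The exponent in polar coordinates and the decay of `F` -/

/-- Beyond `1` the function is at most `u ^ (1 - α)`, and `1 - α < -1`. -/
theorem integrableOn_div_one_add_rpow {α : ℝ} (hα : 2 < α) :
    IntegrableOn (fun u : ℝ => u / (1 + u ^ α)) (Ioi 0) := by
  have hmeas : Measurable fun u : ℝ => u / (1 + u ^ α) := by fun_prop
  rw [← Ioc_union_Ioi_eq_Ioi zero_le_one]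
  refine IntegrableOn.union ?_ ?_
  · refine Measure.integrableOn_of_bounded (M := 1) (by simp) hmeas.aestronglyMeasurable ?_
    refine (ae_restrict_mem measurableSet_Ioc).mono fun u hu => ?_
    have := hu.1
    have h2 : 0 ≤ u ^ α := by positivity
    rw [Real.norm_of_nonneg (by positivity), div_le_one (by positivity)]
    linarith [hu.2]
  · refine (integrableOn_Ioi_rpow_of_lt (a := 1 - α) (by linarith) zero_lt_one).mono'
      hmeas.aestronglyMeasurable ?_
    refine (ae_restrict_mem measurableSet_Ioi).mono fun u (hu : 1 < u) => ?_
    have hu0 : 0 < u := zero_lt_one.trans hu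
    have h2 : 0 < u ^ α := by positivity
    rw [Real.norm_of_nonneg (by positivity), Real.rpow_sub hu0, Real.rpow_one]
    gcongr
    linarith

theorem integral_plane_fun_norm (F : ℝ → ℂ) :
    ∫ x : Plane, F ‖x‖ = 2 * Real.pi * ∫ u in Ioi (0 : ℝ), u * F u := by
  rw [integral_fun_norm_addHaar volume F, Measure.real, EuclideanSpace.volume_ball_fin_two]
  simp [ENNReal.toReal_ofReal Real.pi_pos.le, mul_assoc]

section Exponent

variable {P₁ α TI TE : ℝ}

theorem meanEnergy_nonneg (hP : 0 < P₁) (hTI : 0 < TI) (hTE : 0 < TE) (p : Plane × ℝ) :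
    0 ≤ meanEnergy P₁ α TI TE p := by
  have := overlap_nonneg hTI hTE p.2
  unfold meanEnergy
  positivity

theorem measurable_meanEnergy (P₁ α TI TE : ℝ) : Measurable (meanEnergy P₁ α TI TE) := by
  have := measurable_overlap TI TE
  unfold meanEnergy
  fun_prop

theorem integrable_meanEnergy (hα : 2 < α) (hTI : 0 < TI) (hTE : 0 < TE) :
    Integrable (meanEnergy P₁ α TI TE) := by
  have h : Integrable fun x : Plane => (1 + ‖x‖ ^ α)⁻¹ := by
    rw [integrable_fun_norm_addHaar volume (f := fun u : ℝ => (1 + u ^ α)⁻¹)]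
    simpa [div_eq_mul_inv] using integrableOn_div_one_add_rpow hα
  exact h.mul_prod ((integrable_overlap hTI hTE).const_mul P₁)

/-- Dividing numerator and denominator by `1 + u ^ α` gives `u * (i a / (1 - i a))` with `a = z P₁
ψ(t) / (1 + u ^ α)`. -/
theorem charIntegrand_eq (z t : ℝ) {u : ℝ} (hu : 0 ≤ u) :
    charIntegrand P₁ α TI TE z t u
      = u * ((1 - Complex.I * (z * ((1 + u ^ α)⁻¹ * (P₁ * overlap TI TE t)) : ℝ))⁻¹ - 1) := by
  have hD : (1 + u ^ α : ℝ) ≠ 0 := by positivity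
  have hD' : (1 + ((u ^ α : ℝ) : ℂ)) ≠ 0 := by exact_mod_cast hD
  have h1 := one_sub_I_mul_ne_zero (z * ((1 + u ^ α)⁻¹ * (P₁ * overlap TI TE t)))
  have h2 : 1 + ((u ^ α : ℝ) : ℂ) - Complex.I * z * P₁ * (overlap TI TE t : ℝ)
      = (1 + ((u ^ α : ℝ) : ℂ)) *
        (1 - Complex.I * (z * ((1 + u ^ α)⁻¹ * (P₁ * overlap TI TE t)) : ℝ)) := by
    push_cast
    field_simp
  rw [charIntegrand, h2, div_eq_iff (mul_ne_zero hD' h1)]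
  have h3 : ∀ D w : ℂ, w ≠ 0 → u * (w⁻¹ - 1) * (D * w) = D * (u * (1 - w)) := by
    intro D w hw
    field_simp
  rw [h3 _ _ h1]
  push_cast
  field_simp
  ring

theorem norm_inv_one_sub_I_mul_sub_one_le (a : ℝ) : ‖(1 - Complex.I * a)⁻¹ - 1‖ ≤ |a| := by
  have h0 := one_sub_I_mul_ne_zero a
  have h1 := one_le_norm_one_sub_I_mul a
  rw [show (1 - Complex.I * a)⁻¹ - 1 = Complex.I * a / (1 - Complex.I * a) by field_simp; ring,
    norm_div, norm_mul, Complex.norm_I, one_mul, Complex.norm_real]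
  exact div_le_self (abs_nonneg _) h1

theorem re_inv_one_sub_I_mul_sub_one (a : ℝ) :
    ((1 - Complex.I * a)⁻¹ - 1).re = -(a ^ 2 / (1 + a ^ 2)) := by
  have : (1 + a ^ 2) ≠ 0 := by positivity
  simp only [Complex.sub_re, Complex.inv_re, Complex.normSq_apply, Complex.one_re, Complex.mul_re,
    Complex.I_re, Complex.I_im, Complex.ofReal_re, Complex.ofReal_im, Complex.sub_im,
    Complex.one_im, Complex.mul_im]
  ring_nf
  field_simp
  ring

theorem norm_charIntegrand_le (hP : 0 < P₁) (hTI : 0 < TI) (hTE : 0 < TE) (z t : ℝ) {u : ℝ}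
    (hu : 0 ≤ u) : ‖charIntegrand P₁ α TI TE z t u‖ ≤ |z| * P₁ * TI * (u / (1 + u ^ α)) := by
  have h0 := overlap_nonneg hTI hTE t
  rw [charIntegrand_eq z t hu, norm_mul, Complex.norm_real, Real.norm_of_nonneg hu]
  calc u * _ ≤ u * |z * ((1 + u ^ α)⁻¹ * (P₁ * overlap TI TE t))| := by
        gcongr
        exact norm_inv_one_sub_I_mul_sub_one_le _
    _ = |z| * P₁ * overlap TI TE t * (u / (1 + u ^ α)) := by
        rw [abs_mul, abs_of_nonneg (a := _ * (_ * _)) (by positivity)]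
        ring
    _ ≤ _ := by
        gcongr
        exact overlap_le hTI t

theorem integrableOn_charIntegrand (hP : 0 < P₁) (hα : 2 < α) (hTI : 0 < TI) (hTE : 0 < TE)
    (z : ℝ) : IntegrableOn (fun p : ℝ × ℝ => charIntegrand P₁ α TI TE z p.1 p.2)
      (Ioc (-TI) TE ×ˢ Ioi (0 : ℝ)) := by
  have hmeas : Measurable fun p : ℝ × ℝ => charIntegrand P₁ α TI TE z p.1 p.2 := by
    have := measurable_overlap TI TE
    unfold charIntegrand
    fun_prop
  have hb : IntegrableOn (fun p : ℝ × ℝ => (|z| * P₁ * TI) * (p.2 / (1 + p.2 ^ α)))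
      (Ioc (-TI) TE ×ˢ Ioi (0 : ℝ)) := by
    rw [IntegrableOn, Measure.volume_eq_prod, ← Measure.prod_restrict]
    exact Integrable.mul_prod (f := fun _ : ℝ => |z| * P₁ * TI) (integrable_const _)
      (integrableOn_div_one_add_rpow hα)
  refine hb.mono' hmeas.aestronglyMeasurable ?_
  refine (ae_restrict_mem (measurableSet_Ioc.prod measurableSet_Ioi)).mono fun p hp => ?_
  exact norm_charIntegrand_le hP hTI hTE z p.1 (le_of_lt hp.2)

theorem integrable_exponent (hα : 2 < α) (hTI : 0 < TI) (hTE : 0 < TE) (z : ℝ) :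
    Integrable fun p : Plane × ℝ =>
      (1 - Complex.I * (z * meanEnergy P₁ α TI TE p : ℝ))⁻¹ - 1 := by
  refine ((integrable_meanEnergy (P₁ := P₁) hα hTI hTE).const_mul z).norm.mono' ?_
    (Eventually.of_forall fun p => norm_inv_one_sub_I_mul_sub_one_le _)
  have := measurable_meanEnergy P₁ α TI TE
  exact (by fun_prop : Measurable _).aestronglyMeasurable

theorem energyCharFun_eq {l₁ : ℝ} (hl : 0 < l₁) (hα : 2 < α) (hTI : 0 < TI) (hTE : 0 < TE)
    (z : ℝ) : energyCharFun l₁ P₁ α TI TE z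
      = Complex.exp (∫ p, ((1 - Complex.I * (z * meanEnergy P₁ α TI TE p : ℝ))⁻¹ - 1)
        ∂(ENNReal.ofReal l₁ • (volume : Measure (Plane × ℝ)))) := by
  rw [integral_smul_measure, ENNReal.toReal_ofReal hl.le, energyCharFun, Measure.volume_eq_prod,
    integral_prod_symm _ (integrable_exponent hα hTI hTE z)]
  congr 1
  have h1 : ∀ t : ℝ, ∫ x : Plane, ((1 - Complex.I * (z * meanEnergy P₁ α TI TE (x, t) : ℝ))⁻¹ - 1)
      = 2 * Real.pi * ∫ u in Ioi (0 : ℝ), charIntegrand P₁ α TI TE z t u := by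
    intro t
    refine (integral_plane_fun_norm fun u =>
      (1 - Complex.I * (z * ((1 + u ^ α)⁻¹ * (P₁ * overlap TI TE t)) : ℝ))⁻¹ - 1).trans ?_
    congr 1
    refine setIntegral_congr_fun measurableSet_Ioi fun u (hu : 0 < u) => ?_
    exact (charIntegrand_eq z t hu.le).symm
  simp_rw [h1]
  rw [integral_const_mul, intervalIntegral.integral_of_le (by linarith),
    setIntegral_eq_integral_of_forall_compl_eq_zero, Complex.real_smul]
  · ring
  · intro t ht
    simp [charIntegrand, overlap_eq_zero_of_notMem hTI hTE ht]

theorem norm_energyCharFun {l₁ : ℝ} (hl : 0 < l₁) (hα : 2 < α) (hTI : 0 < TI) (hTE : 0 < TE)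
    (z : ℝ) : ‖energyCharFun l₁ P₁ α TI TE z‖
      = Real.exp (-(l₁ * ∫ p, (z * meanEnergy P₁ α TI TE p) ^ 2 /
          (1 + (z * meanEnergy P₁ α TI TE p) ^ 2))) := by
  rw [energyCharFun_eq hl hα hTI hTE, Complex.norm_exp, integral_smul_measure,
    ENNReal.toReal_ofReal hl.le, Complex.smul_re, ← mul_neg, ← integral_neg, smul_eq_mul]
  congr 2
  refine (integral_re (integrable_exponent hα hTI hTE z)).symm.trans ?_
  congr with p
  exact re_inv_one_sub_I_mul_sub_one _

/-- On a cylinder where `z f ≥ 1` the integrand of the exponent is at least `1 / 2`; the radius of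
the cylinder grows like `z ^ (1 / α)`. -/
theorem norm_energyCharFun_le {l₁ : ℝ} (hl : 0 < l₁) (hP : 0 < P₁) (hα : 2 < α) (hTI : 0 < TI)
    (hTE : 0 < TE) {z : ℝ} (hz : 4 ≤ z * (P₁ * min TI TE)) :
    ‖energyCharFun l₁ P₁ α TI TE z‖
      ≤ Real.exp (-(l₁ * Real.pi * TI / 4 * (z * (P₁ * min TI TE / 4)) ^ (2 / α))) := by
  have hm : 0 < min TI TE := lt_min hTI hTE
  have hz0 : 0 < z := by
    by_contra hn
    have : z * (P₁ * min TI TE) ≤ 0 :=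
      mul_nonpos_of_nonpos_of_nonneg (not_lt.1 hn) (by positivity)
    linarith
  -- On the time window `z P₁ ψ ≥ 2 w`, and `hz` says `w ≥ 1`; hence `2 w ≥ 1 + ‖x‖ ^ α` as soon as
  -- `‖x‖ ^ α ≤ w`, which fixes the radius `R`.
  set w : ℝ := z * (P₁ * min TI TE / 4) with hw
  have hw1 : 1 ≤ w := by rw [hw]; linarith
  set R : ℝ := w ^ (1 / α) with hR
  have hR0 : 0 ≤ R := by positivity
  set S : Set (Plane × ℝ) := Metric.ball 0 R ×ˢ Icc (-(TI / 2)) 0 with hS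
  have hSm : MeasurableSet S := measurableSet_ball.prod measurableSet_Icc
  have hvol : volume.real S = Real.pi * TI / 2 * w ^ (2 / α) := by
    have hR2 : R ^ 2 = w ^ (2 / α) := by
      rw [hR, ← Real.rpow_natCast, ← Real.rpow_mul (by positivity)]
      congr 1
      push_cast
      ring
    rw [Measure.real, hS, Measure.volume_eq_prod, Measure.prod_prod,
      EuclideanSpace.volume_ball_fin_two, Real.volume_Icc, ← hR2]
    simp only [ENNReal.toReal_mul, ENNReal.toReal_pow, ENNReal.toReal_ofReal hR0,
      ENNReal.toReal_ofReal Real.pi_pos.le, sub_neg_eq_add, zero_add,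
      ENNReal.toReal_ofReal (half_pos hTI).le]
    ring
  have hfin : volume S ≠ ∞ := by
    rw [hS, Measure.volume_eq_prod, Measure.prod_prod]
    exact ENNReal.mul_ne_top measure_ball_lt_top.ne (by simp)
  have hlow : ∀ p ∈ S, 1 ≤ z * meanEnergy P₁ α TI TE p := by
    intro p hp
    have h1 : ‖p.1‖ < R := by simpa using hp.1
    have h2 : ‖p.1‖ ^ α ≤ w := by
      calc ‖p.1‖ ^ α ≤ R ^ α := by gcongr
        _ = w := by
          rw [hR, ← Real.rpow_mul (by positivity), one_div_mul_cancel (by positivity),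
            Real.rpow_one]
    have h3 := half_min_le_overlap hTI hTE hp.2
    have h4 : 2 * w ≤ z * (P₁ * overlap TI TE p.2) := by
      calc 2 * w = z * (P₁ * (min TI TE / 2)) := by rw [hw]; ring
        _ ≤ _ := by gcongr
    have h5 : 0 < 1 + ‖p.1‖ ^ α := by positivity
    rw [meanEnergy, mul_left_comm, ← div_eq_inv_mul, one_le_div h5]
    linarith
  rw [norm_energyCharFun hl hα hTI hTE]
  set q : Plane × ℝ → ℝ := fun p => (z * meanEnergy P₁ α TI TE p) ^ 2 /
    (1 + (z * meanEnergy P₁ α TI TE p) ^ 2) with hq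
  have hqi : Integrable q := by
    refine (integrable_exponent (P₁ := P₁) hα hTI hTE z).re.neg.congr
      (Eventually.of_forall fun p => ?_)
    simp only [Pi.neg_apply, RCLike.re_to_complex, re_inv_one_sub_I_mul_sub_one, neg_neg, hq]
  have hge : 1 / 2 * volume.real S ≤ ∫ p, q p := by
    calc 1 / 2 * volume.real S = ∫ p in S, (1 / 2 : ℝ) := by
          rw [setIntegral_const, smul_eq_mul, mul_comm]
      _ ≤ ∫ p in S, q p := by
          refine setIntegral_mono_on (integrableOn_const hfin) hqi.integrableOn hSm
            fun p hp => ?_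
          have := one_le_pow₀ (hlow p hp) (n := 2)
          rw [hq, div_le_div_iff₀ two_pos (by positivity)]
          linarith
      _ ≤ ∫ p, q p :=
          setIntegral_le_integral hqi (Eventually.of_forall fun p => by
            simp only [hq, Pi.zero_apply]
            positivity)
  rw [hvol] at hge
  refine Real.exp_le_exp.2 (neg_le_neg ?_)
  calc l₁ * Real.pi * TI / 4 * w ^ (2 / α)
      = l₁ * (1 / 2 * (Real.pi * TI / 2 * w ^ (2 / α))) := by ring
    _ ≤ _ := by gcongr

end Exponent

end WirelessHarvest

/-! ### The energy-coverage probability -/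

theorem proposition1 {Ω : Type*} [MeasurableSpace Ω] (P : Measure Ω) [IsProbabilityMeasure P]
    (l₁ P₁ α TI TE ε : ℝ) (hl : 0 < l₁) (hP : 0 < P₁) (hα : 2 < α)
    (hTI : 0 < TI) (hTE : 0 < TE) (hε : 0 ≤ ε)
    (X : ℕ → Ω → WirelessHarvest.Plane × ℝ) (h : ℕ → Ω → ℝ)
    (hX : WirelessHarvest.IsPoissonPointProcess X
      (ENNReal.ofReal l₁ • (volume : Measure (WirelessHarvest.Plane × ℝ))) P)
    (hh : WirelessHarvest.HasIndepExpMarks X h P) :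
    (∀ z : ℝ, IntegrableOn
      (fun p : ℝ × ℝ => WirelessHarvest.charIntegrand P₁ α TI TE z p.1 p.2)
      (Set.Ioc (-TI) TE ×ˢ Set.Ioi (0 : ℝ))) ∧
    IntegrableOn
      (fun z : ℝ => (Complex.exp (-Complex.I * z * ε) *
        WirelessHarvest.energyCharFun l₁ P₁ α TI TE z).im / z) (Set.Ioi (0 : ℝ)) ∧
    P.real {ω | ENNReal.ofReal ε < WirelessHarvest.harvestedEnergy P₁ α TI TE X h ω} =
      1 / 2 + 1 / Real.pi * ∫ z in Set.Ioi (0 : ℝ),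
        (Complex.exp (-Complex.I * z * ε) *
          WirelessHarvest.energyCharFun l₁ P₁ α TI TE z).im / z := by
  open WirelessHarvest Filter in
  have hf := measurable_meanEnergy P₁ α TI TE
  have hi : Integrable (meanEnergy P₁ α TI TE)
      (ENNReal.ofReal l₁ • (volume : Measure (Plane × ℝ))) :=
    (integrable_meanEnergy hα hTI hTE).smul_measure ENNReal.ofReal_ne_top
  -- `ENNReal.ofReal l₁` unfolds to the coercion of `Real.toNNReal l₁`, for which the instance is
  -- found.
  have hΛ : SigmaFinite (ENNReal.ofReal l₁ • (volume : Measure (Plane × ℝ))) :=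
    inferInstanceAs (SigmaFinite (Real.toNNReal l₁ • (volume : Measure (Plane × ℝ))))
  set S : Ω → ℝ := fun ω => (shotNoise X h (meanEnergy P₁ α TI TE) ω).toReal with hSdef
  have hS : Measurable S := (measurable_shotNoise hX hh hf).ennreal_toReal
  have hprob : IsProbabilityMeasure (P.map S) := Measure.isProbabilityMeasure_map hS.aemeasurable
  have hchar : ∀ z : ℝ, charFun (P.map S) z = energyCharFun l₁ P₁ α TI TE z := by
    intro z
    rw [energyCharFun_eq hl hα hTI hTE, ← integral_exp_shotNoise hX hh hf hi
      (meanEnergy_nonneg hP hTI hTE), charFun_apply_real,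
      integral_map hS.aemeasurable (by fun_prop : Measurable _).aestronglyMeasurable]
    congr with ω
    congr 1
    ring
  have hm : Integrable (fun x : ℝ => x) (P.map S) :=
    (integrable_map_measure measurable_id.aestronglyMeasurable hS.aemeasurable).2
      (integrable_toReal_shotNoise hX hh hf hi)
  have hc : 0 < P₁ * min TI TE := mul_pos hP (lt_min hTI hTE)
  have hF : IntegrableOn (charFun (P.map S)) (Ioi 0) := by
    have hz0 : 0 < 4 / (P₁ * min TI TE) := by positivity
    rw [← Ioc_union_Ioi_eq_Ioi hz0.le]
    refine IntegrableOn.union ?_ ?_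
    · exact Measure.integrableOn_of_bounded (M := 1) (by simp)
        measurable_charFun.aestronglyMeasurable
        (Eventually.of_forall fun z => norm_charFun_le_one z)
    -- With `s := 0` the power factor is `1`, leaving the pure stretched exponential.
    · have hb := integrableOn_rpow_mul_exp_neg_mul_rpow (p := 2 / α) (s := 0)
        (b := l₁ * Real.pi * TI / 4 * (P₁ * min TI TE / 4) ^ (2 / α))
        (by norm_num) (by positivity) (by positivity)
      refine (hb.mono_set (Ioi_subset_Ioi hz0.le)).mono'
        measurable_charFun.aestronglyMeasurable ?_
      refine (ae_restrict_mem measurableSet_Ioi).mono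
        fun z (hz : 4 / (P₁ * min TI TE) < z) => ?_
      rw [hchar, Real.rpow_zero, one_mul]
      refine (norm_energyCharFun_le hl hP hα hTI hTE ((div_le_iff₀ hc).1 hz.le)).trans_eq ?_
      rw [Real.mul_rpow (hz0.trans hz).le (by positivity)]
      congr 1
      ring
  refine ⟨integrableOn_charIntegrand hP hα hTI hTE, ?_, ?_⟩
  · simpa only [hchar] using integrableOn_im_exp_mul_charFun_div hm hF ε
  · have hg := measureReal_Ioi_eq_gilPelaez hm hF ε
    simp only [hchar] at hg
    rw [← hg, map_measureReal_apply hS measurableSet_Ioi]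
    refine measureReal_congr ?_
    -- Where the energy is infinite, `toReal` would return `0` and the two events could differ; this
    -- is a null set.
    filter_upwards [ae_shotNoise_ne_top hX hh hf hi] with ω hω
    refine propext ?_
    change ENNReal.ofReal ε < harvestedEnergy P₁ α TI TE X h ω ↔ ε < S ω
    rw [harvestedEnergy_eq_shotNoise hP hTI hTE, hSdef, ENNReal.ofReal_lt_iff_lt_toReal hε hω]
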